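/- For a finite set $P$ of $n$ points in the plane let $\mathcal{E}(P)$ be the family of the $\binom n2$ distances $\lVert ab\rVert$ of unordered pairs of distinct points of $P$, counted with multiplicity, and let $\delta^*$ be its $k$-th smallest member, $1\le k\le\binom n2$. Fix a degree $d$ and a real constant $C$. A (non-final) stage of the distance-selection algorithm starts from an interval $I_{j-1}=(\alpha_{j-1},\beta_{j-1}]\subseteq(0,+\infty]$ containing $\delta^*$ and produces an interval $I_j$ containing $\delta^*$ as follows. (1) It takes two collections $\Gamma=\{A_t\times B_t\}$ and $\Pi=\{A'_s\times B'_s\}$ of complete bipartite graphs with all vertex sets contained in $P$, each collection being edge-disjoint (edges are ordered pairs), such that $\lVert ab\rVert\in I_{j-1}$ for all $(a,b)\in A_t\times B_t\in\Gamma$, and every $(a,b)\in P\times P$ with $\lVert ab\rVert\in I_{j-1}$ lies in a unique graph of $\Gamma$ or in a unique graph of $\Pi$; moreover $|\Gamma|,|\Pi|\le C\,n^{4/3}/(\log\log n)^4$, $\sum_t|A_t|,\sum_t|B_t|\le C\,n^{4/3}$, and $|A'_s|,|B'_s|\le C(\log\log n)^3$ for all $s$. Put $m_{j-1}=\sum_t|A_t||B_t|$.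 The stage is non-final, i.e. $m_{j-1}>n^{4/3}\log n$. (2) For each $t$, after renaming so that $|A_t|\ge|B_t|$, the set $A_t$ is partitioned into $g=\lfloor|A_t|/|B_t|\rfloor$ blocks $A_{t1},\dots,A_{tg}$ (none if $B_t=\emptyset$), all of size $|B_t|$ except that the last one has at least $|B_t|$ and at most $2|B_t|-1$ elements. For each block, $G_{ti}$ is a $d$-regular LPS-expander on the vertex set $A_{ti}\cup B_t$, that is, a $d$-regular graph (loops and parallel edges allowed) such that every eigenvalue of its adjacency matrix having an eigenvector orthogonal to the constant vectors has absolute value at most $2\sqrt{d-1}$. (3) Let $S$ be the family of the distances $\lVert ab\rVert$ over all edges $ab$ of the graphs $G_{ti}$ with $a\in A_{ti}$, $b\in B_t$, each with weight $|A_{ti}||B_t|/(|A_{ti}|+|B_t|)$. The interval $I_{j-1}$ is partitioned into $h$ consecutive half-open intervals $(c_{i},c_{i+1}]$, $1\le h\le 2d$, in each of which the members of $S$ have total weight at least $m_{j-1}/4$ and at most $m_{j-1}/2$, and $I_j$ is the one that contains $\delta^*$. Then there is an absolute constant $d_0$ such that for every $C$ there is a constant $\rho$ with $0<\rho<1$,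 depending only on $C$, such that for all $d\ge d_0$, all $P$ and $k$, and every such stage, the number of values of $\mathcal{E}(P)$ in $I_j$ is at most $\rho$ times the number of values of $\mathcal{E}(P)$ in $I_{j-1}$. -/

import Mathlib

namespace DistanceSelection

noncomputable section

/-- The Euclidean plane. -/
abbrev Plane : Type := EuclideanSpace ℝ (Fin 2)

/-- A half-open interval `(lo, hi]` of the real line; `hi = ⊤` encodes `(lo, +∞]`. -/
structure Interval where
  lo : EReal
  hi : EReal

/-- The real numbers lying in the interval `(lo, hi]`. -/
def Interval.toSet (I : Interval) : Set ℝ :=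
  {x : ℝ | I.lo < (x : EReal) ∧ (x : EReal) ≤ I.hi}

/-- The family `ℰ(P)` of interpoint distances of `P`: one value for every unordered pair of
distinct points of `P` (so it has `|P| choose 2` members, counted with multiplicity). -/
def interpointDistances (P : Finset Plane) : Multiset ℝ :=
  open Classical in
  (P.sym2.filter (fun e => ¬ e.IsDiag)).val.map
    (Sym2.lift ⟨fun a b => dist a b, fun a b => dist_comm a b⟩)

/-- The number of values of `ℰ(P)` in the interval `I`. -/
def countIn (P : Finset Plane) (I : Interval) : ℕ :=
  open Classical in (interpointDistances P).countP (fun x => x ∈ I.toSet)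

/-- `δ` is the `k`-th smallest member (`k = 1` being the smallest) of the family `s`. -/
def IsKthSmallest (s : Multiset ℝ) (k : ℕ) (δ : ℝ) : Prop :=
  open Classical in s.countP (fun x => x < δ) < k ∧ k ≤ s.countP (fun x => x ≤ δ)

/-- A complete bipartite graph `A × B`, given by its two vertex sets. Its edges are the ordered
pairs in `A × B`. -/
abbrev Biclique : Type := Finset Plane × Finset Plane

/-- `Γ` and `U` form a solution of the partial batched range searching problem for `A`, `B` and
the interval `I`: both are collections of edge-disjoint complete bipartite graphs between `A` and
`B`, all pairs recorded in `Γ` have their distance in `I`, and every pair with distance in `I` is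
recorded in a unique graph of `Γ` or in a unique graph of `U` (the uncertain pairs). -/
structure IsPartialBRS (A B : Finset Plane) (I : Interval) (Γ U : Finset Biclique) : Prop where
  subset_Γ : ∀ p ∈ Γ, p.1 ⊆ A ∧ p.2 ⊆ B
  subset_U : ∀ p ∈ U, p.1 ⊆ A ∧ p.2 ⊆ B
  edgeDisjoint_Γ : ∀ p ∈ Γ, ∀ q ∈ Γ, p ≠ q → Disjoint (p.1 ×ˢ p.2) (q.1 ×ˢ q.2)
  edgeDisjoint_U : ∀ p ∈ U, ∀ q ∈ U, p ≠ q → Disjoint (p.1 ×ˢ p.2) (q.1 ×ˢ q.2)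
  sound : ∀ p ∈ Γ, ∀ a ∈ p.1, ∀ b ∈ p.2, dist a b ∈ I.toSet
  complete : ∀ a ∈ A, ∀ b ∈ B, dist a b ∈ I.toSet →
    (∃! p : Biclique, p ∈ Γ ∧ a ∈ p.1 ∧ b ∈ p.2) ∨ (∃! p : Biclique, p ∈ U ∧ a ∈ p.1 ∧ b ∈ p.2)

/-- The size guarantees, with implied constant `C`, for the collections computed from `n` points
at the beginning of a stage. -/
structure HasStageSize (C : ℝ) (n : ℕ) (Γ U : Finset Biclique) : Prop where
  card_Γ : (Γ.card : ℝ) ≤ C * ((n : ℝ) ^ (4 / 3 : ℝ) / Real.log (Real.log n) ^ 4)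
  sum_left : (∑ p ∈ Γ, (p.1.card : ℝ)) ≤ C * (n : ℝ) ^ (4 / 3 : ℝ)
  sum_right : (∑ p ∈ Γ, (p.2.card : ℝ)) ≤ C * (n : ℝ) ^ (4 / 3 : ℝ)
  card_U : (U.card : ℝ) ≤ C * ((n : ℝ) ^ (4 / 3 : ℝ) / Real.log (Real.log n) ^ 4)
  card_left_U : ∀ p ∈ U, (p.1.card : ℝ) ≤ C * Real.log (Real.log n) ^ 3
  card_right_U : ∀ p ∈ U, (p.2.card : ℝ) ≤ C * Real.log (Real.log n) ^ 3

/-- `m = ∑ₜ |Aₜ| |Bₜ|`, the number of pairs recorded in `Γ`. -/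
def numPairs (Γ : Finset Biclique) : ℕ := ∑ p ∈ Γ, p.1.card * p.2.card

/-- The larger side of a complete bipartite graph (called `Aₜ` after the renaming). -/
def major (p : Biclique) : Finset Plane := if p.1.card < p.2.card then p.2 else p.1

/-- The smaller side of a complete bipartite graph (called `Bₜ` after the renaming). -/
def minor (p : Biclique) : Finset Plane := if p.1.card < p.2.card then p.1 else p.2

/-- The number `g = ⌊|Aₜ| / |Bₜ|⌋` of blocks into which the larger side is cut (it is `0` if the
smaller side is empty, that is, if the graph has no edges). -/
def numBlocks (p : Biclique) : ℕ := (major p).card / (minor p).card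

/-- `part 0, …, part (g - 1)` is a partition of the larger side `Aₜ` into `g` blocks, all of size
`|Bₜ|` except for the last one, which has at least `|Bₜ|` and at most `2 |Bₜ| - 1` elements. -/
structure IsBlockPartition (p : Biclique) (part : ℕ → Finset Plane) : Prop where
  disjoint : ∀ i < numBlocks p, ∀ j < numBlocks p, i ≠ j → Disjoint (part i) (part j)
  cover : ∀ x : Plane, x ∈ major p ↔ ∃ i < numBlocks p, x ∈ part i
  card_block : ∀ i, i + 1 < numBlocks p → (part i).card = (minor p).card
  card_last : ∀ i, i + 1 = numBlocks p →
    (minor p).card ≤ (part i).card ∧ (part i).card < 2 * (minor p).card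

/-- `W` is the adjacency matrix (`W x y` is the number of edges joining `x` and `y`) of a
`d`-regular graph on the vertex set `V` that is an expander with the Lubotzky–Phillips–Sarnak
eigenvalue bound: every eigenvalue other than the trivial eigenvalue `d` of the constant vectors
has absolute value at most `2 √(d - 1)`. Parallel edges and loops are permitted; a simple graph is
the case in which all entries are `0` or `1` and the diagonal vanishes. -/
structure IsLPSExpander {α : Type*} (d : ℕ) (V : Finset α) (W : α → α → ℕ) : Prop where
  symm : ∀ x ∈ V, ∀ y ∈ V, W x y = W y x
  regular : ∀ x ∈ V, ∑ y ∈ V, W x y = d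
  eigenvalue_le : ∀ (f : α → ℝ) (μ : ℝ), (∃ x ∈ V, f x ≠ 0) → ∑ x ∈ V, f x = 0 →
    (∀ x ∈ V, ∑ y ∈ V, (W x y : ℝ) * f y = μ * f x) → |μ| ≤ 2 * Real.sqrt ((d : ℝ) - 1)

/-- The total weight of the distances of `S` that lie in `J`. Here `S` has one distance `‖ab‖` for
every edge joining `a ∈ Aₜᵢ` and `b ∈ Bₜ` in the expander `Gₜᵢ`, and every such distance has
weight `|Aₜᵢ| |Bₜ| / (|Aₜᵢ| + |Bₜ|)`. -/
def weightIn (Γ : Finset Biclique) (part : Biclique → ℕ → Finset Plane)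
    (G : Biclique → ℕ → Plane → Plane → ℕ) (J : Interval) : ℝ :=
  open Classical in
  ∑ p ∈ Γ, ∑ i ∈ Finset.range (numBlocks p), ∑ a ∈ part p i, ∑ b ∈ minor p,
    if dist a b ∈ J.toSet then
      (G p i a b : ℝ) * (((part p i).card : ℝ) * ((minor p).card : ℝ)
        / (((part p i).card : ℝ) + ((minor p).card : ℝ)))
    else 0

/-- One stage, other than the last one, of the distance selection algorithm for the point set `P`
and the rank `k`, with expanders of degree `d` and implied constant `C` in the size guarantees: it
starts from the interval `I` (called `I_{j-1}` in the `j`-th stage) and ends with the interval `J`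
(called `I_j`). -/
structure Stage (d : ℕ) (C : ℝ) (P : Finset Plane) (k : ℕ) (I J : Interval) where
  /-- the sought distance, which lies in the current interval `I ⊆ (0, +∞]` -/
  δ : ℝ
  isKth : IsKthSmallest (interpointDistances P) k δ
  lo_nonneg : 0 ≤ I.lo
  mem_I : δ ∈ I.toSet
  /-- the two collections that solve partial batched range searching for `P`, `P` and `I` -/
  Γ : Finset Biclique
  U : Finset Biclique
  isBRS : IsPartialBRS P P I Γ U
  size : HasStageSize C P.card Γ U
  /-- the stage is not the last one -/
  not_last : (P.card : ℝ) ^ (4 / 3 : ℝ) * Real.log P.card < (numPairs Γ : ℝ)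
  /-- the blocks `Aₜᵢ` -/
  part : Biclique → ℕ → Finset Plane
  isPartition : ∀ p ∈ Γ, (minor p).Nonempty → IsBlockPartition p (part p)
  /-- the expanders `Gₜᵢ` on the vertex sets `Aₜᵢ ∪ Bₜ` -/
  G : Biclique → ℕ → Plane → Plane → ℕ
  isExpander : ∀ p ∈ Γ, ∀ i < numBlocks p,
    open Classical in IsLPSExpander d (part p i ∪ minor p) (G p i)
  /-- the partition of `I` into `h` consecutive intervals `(c i, c (i + 1)]` -/
  h : ℕ
  one_le_h : 1 ≤ h
  h_le : h ≤ 2 * d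
  c : ℕ → EReal
  c_zero : c 0 = I.lo
  c_last : c h = I.hi
  c_mono : ∀ i < h, c i ≤ c (i + 1)
  weight_ge : ∀ i < h, (numPairs Γ : ℝ) / 4 ≤ weightIn Γ part G ⟨c i, c (i + 1)⟩
  weight_le : ∀ i < h, weightIn Γ part G ⟨c i, c (i + 1)⟩ ≤ (numPairs Γ : ℝ) / 2
  /-- the index of the interval of the partition that contains `δ` -/
  l : ℕ
  l_lt : l < h
  J_eq : J = ⟨c l, c (l + 1)⟩
  mem_J : δ ∈ J.toSet

end

end DistanceSelection

namespace DistanceSelection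

open Finset

/-! The argument shows that a positive fraction of the pairs recorded in `Γ` have their distance
outside `J`. It rests on a dichotomy for one block `A × B` (`card_mul_card_le_of_expander`): either
at least `η * |A| * |B|` of its pairs have their distance outside `J`, or the expander edges with
distance in `J` already weigh at least `|A| * |B|`. Summing over all blocks, with `m = numPairs Γ`,
gives `m ≤ lost / η + (weight in J)`. The weight in `J` is at most `m / 2`, so at least `η * m / 2`
recorded pairs are lost.

The dichotomy combines two facts. By `exists_homogeneous_interval`, there are fixed fractions `A'`
of `A` and `B'` of `B` such that each annulus around a point of `B'` contains all of `A'` or none of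
it. This holds because comparing a distance with a fixed radius amounts to taking the sign of an
entry of a matrix of rank at most 4, and bounded rank forces large sign-homogeneous submatrices. If
few pairs are lost, most points of `B'` are of the "all" kind, and the expander mixing lemma
(`IsLPSExpander.le_sum_sum`) then yields at least `|A| + |B|` edges with distance in `J`.

Finally, the uncertain pairs number at most `K * n ^ (4 / 3) * log n ≤ K * m` in a non-final stage,
with `K` depending only on `C`. So the lost pairs are a positive fraction of all pairs with distance
in `I`. The constants `η` and `d₀` come from the geometry alone; `C` enters only through `K`. -/

/-! ### Spectral bound and expander mixing. -/

theorem norm_toEuclideanLin_le {ι : Type*} [Fintype ι] [DecidableEq ι]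
    {M : Matrix ι ι ℝ} (hM : M.IsHermitian) {r : ℝ} (hr : 0 ≤ r)
    (h : ∀ i, |hM.eigenvalues i| ≤ r) (y : EuclideanSpace ℝ ι) :
    ‖Matrix.toEuclideanLin M y‖ ≤ r * ‖y‖ := by
  have hsymm := Matrix.isSymmetric_toEuclideanLin_iff.mpr hM
  have key : ∀ i, inner ℝ (hM.eigenvectorBasis i) (Matrix.toEuclideanLin M y)
      = hM.eigenvalues i * inner ℝ (hM.eigenvectorBasis i) y := by
    intro i
    rw [← hsymm (hM.eigenvectorBasis i) y]
    have : Matrix.toEuclideanLin M (hM.eigenvectorBasis i)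
        = hM.eigenvalues i • hM.eigenvectorBasis i := by
      ext j
      have := congrFun (hM.mulVec_eigenvectorBasis i) j
      simpa using this
    rw [this, real_inner_smul_left]
  refine le_of_sq_le_sq ?_ (by positivity)
  rw [mul_pow, ← hM.eigenvectorBasis.sum_sq_norm_inner_right (Matrix.toEuclideanLin M y),
    ← hM.eigenvectorBasis.sum_sq_norm_inner_right y, Finset.mul_sum]
  refine Finset.sum_le_sum fun i _ => ?_
  rw [key, norm_mul, mul_pow]
  gcongr
  simpa using h i

/-- The expander mixing lemma (lower bound on the number of edges between two vertex sets). -/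
theorem IsLPSExpander.le_sum_sum {α : Type*} {d : ℕ} {V : Finset α} {W : α → α → ℕ}
    (hW : IsLPSExpander d V W) {S T : Finset α} (hS : S ⊆ V) (hT : T ⊆ V) :
    (d : ℝ) * (S.card * T.card) / V.card
      - 2 * Real.sqrt ((d : ℝ) - 1) * Real.sqrt (S.card * T.card)
      ≤ ∑ x ∈ S, ∑ y ∈ T, (W x y : ℝ) := by
  classical
  rcases V.eq_empty_or_nonempty with rfl | hV
  · simp [Finset.subset_empty.mp hS]
  have hN : (0 : ℝ) < V.card := by exact_mod_cast hV.card_pos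
  set r := 2 * Real.sqrt ((d : ℝ) - 1) with hr
  -- Subtracting the average density sends constants to 0 and leaves the action on their orthogonal
  -- complement unchanged, so the LPS bound controls the whole spectrum of `M`.
  set M : Matrix V V ℝ := Matrix.of fun x y => (W x y : ℝ) - d / V.card with hMdef
  have hM : M.IsHermitian := by
    ext x y
    simp [M, hW.symm x x.2 y y.2]
  have hcol : ∀ y : V, ∑ x : V, M x y = 0 := by
    intro y
    have : ∑ x ∈ V, (W y x : ℝ) = d := by exact_mod_cast hW.regular y y.2
    have h2 : ∑ x : V, (W x y : ℝ) = d := by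
      rw [← this, ← Finset.sum_coe_sort V]
      exact Finset.sum_congr rfl fun x _ => by rw [hW.symm x x.2 y y.2]
    simp only [M, Matrix.of_apply, Finset.sum_sub_distrib, h2]
    simp [mul_div_cancel₀, hN.ne']
  have hev : ∀ i, |hM.eigenvalues i| ≤ r := by
    intro i
    set μ := hM.eigenvalues i
    set g : V → ℝ := (hM.eigenvectorBasis i).ofLp with hg
    have hMg : ∀ x, ∑ y, M x y * g y = μ * g x := fun x => by
      simpa [Matrix.mulVec, dotProduct] using congrFun (hM.mulVec_eigenvectorBasis i) x
    rcases eq_or_ne μ 0 with h0 | h0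
    · rw [h0, abs_zero]; positivity
    -- As the column sums of `M` vanish, an eigenvector for `μ ≠ 0` is orthogonal to the constants,
    -- hence an eigenvector of `W` itself.
    have hsum : ∑ x, g x = 0 := by
      have : μ * ∑ x, g x = 0 := by
        rw [Finset.mul_sum, ← Finset.sum_congr rfl fun x _ => hMg x, Finset.sum_comm]
        exact Finset.sum_eq_zero fun y _ => by rw [← Finset.sum_mul, hcol, zero_mul]
      exact (mul_eq_zero.mp this).resolve_left h0
    have hne : ∃ x, g x ≠ 0 := by
      by_contra! hc
      have : hM.eigenvectorBasis i = 0 := by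
        ext x; exact hc x
      have h1 := hM.eigenvectorBasis.orthonormal.1 i
      rw [this, norm_zero] at h1
      exact zero_ne_one h1
    let f : α → ℝ := fun x => if h : x ∈ V then g ⟨x, h⟩ else 0
    have hf : ∀ x : V, f x = g x := fun x => by simp [f]
    refine hW.eigenvalue_le f μ ?_ ?_ ?_
    · obtain ⟨x, hx⟩ := hne
      exact ⟨x, x.2, by rwa [hf]⟩
    · rw [← Finset.sum_coe_sort V]
      simpa [hf] using hsum
    · intro x hx
      rw [← Finset.sum_coe_sort V, hf ⟨x, hx⟩, ← hMg]
      simp only [hf, M, Matrix.of_apply, sub_mul, Finset.sum_sub_distrib, ← Finset.mul_sum, hsum,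
        mul_zero, sub_zero]
  let ind : Finset α → EuclideanSpace ℝ V := fun R =>
    WithLp.toLp 2 fun x => if (x : α) ∈ R then 1 else 0
  have hsub : ∀ R ⊆ V, ∀ F : α → ℝ, ∑ x : V, (if (x : α) ∈ R then F x else 0) = ∑ x ∈ R, F x := by
    intro R hR F
    rw [Finset.sum_coe_sort V (fun x => if x ∈ R then F x else 0), Finset.sum_ite_mem,
      Finset.inter_eq_right.mpr hR]
  have hnorm : ∀ R ⊆ V, ‖ind R‖ = Real.sqrt R.card := by
    intro R hR
    rw [EuclideanSpace.norm_eq]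
    congr 1
    rw [← show ∑ x ∈ R, (1 : ℝ) = R.card by simp, ← hsub R hR]
    refine Finset.sum_congr rfl fun x _ => ?_
    by_cases hx : (x : α) ∈ R <;> simp [ind, hx]
  have hinner : inner ℝ (ind S) (Matrix.toEuclideanLin M (ind T))
      = ∑ x ∈ S, ∑ y ∈ T, (W x y : ℝ) - (d : ℝ) * (S.card * T.card) / V.card := by
    have h1 : inner ℝ (ind S) (Matrix.toEuclideanLin M (ind T))
        = ∑ x : V, if (x : α) ∈ S then ∑ y ∈ T, ((W x y : ℝ) - d / V.card) else 0 := by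
      simp only [PiLp.inner_apply, ind, Matrix.toLpLin_apply]
      refine Finset.sum_congr rfl fun x _ => ?_
      by_cases hx : (x : α) ∈ S
      · simp [hx, M, Matrix.mulVec, dotProduct,
          ← hsub T hT (fun y => (W x y : ℝ) - d / V.card)]
      · simp [hx]
    rw [h1, hsub S hS fun x => ∑ y ∈ T, ((W x y : ℝ) - d / V.card)]
    simp only [Finset.sum_sub_distrib, Finset.sum_const, nsmul_eq_mul]
    ring
  have h1 := abs_real_inner_le_norm (ind S) (Matrix.toEuclideanLin M (ind T))
  have h2 := norm_toEuclideanLin_le hM (by positivity) hev (ind T)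
  rw [hinner, hnorm S hS] at h1
  rw [hnorm T hT] at h2
  have h3 := (abs_le.mp h1).1
  have h4 := mul_le_mul_of_nonneg_left h2 (Real.sqrt_nonneg (S.card : ℝ))
  rw [Real.sqrt_mul (Nat.cast_nonneg _)]
  linarith

/-! ### Sign-homogeneous submatrices of matrices of bounded rank. -/

/-- Take the least value of `s` on `B` with at least half of `B` at or below it. The next smaller
value fails this condition, which gives the second bound. -/
theorem exists_median {β : Type*} (B : Finset β) (hB : B.Nonempty) (s : β → ℝ) :
    ∃ m : ℝ, B.card ≤ 2 * (B.filter fun b => s b ≤ m).card ∧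
      2 * (B.filter fun b => s b < m).card ≤ B.card := by
  classical
  let T := B.filter fun t => B.card ≤ 2 * (B.filter fun b => s b ≤ s t).card
  have hT : T.Nonempty := by
    obtain ⟨t, ht, hmax⟩ := B.exists_max_image s hB
    refine ⟨t, Finset.mem_filter.mpr ⟨ht, ?_⟩⟩
    rw [Finset.filter_true_of_mem hmax]
    omega
  obtain ⟨t, ht, hmin⟩ := T.exists_min_image s hT
  refine ⟨s t, (Finset.mem_filter.mp ht).2, ?_⟩
  rcases (B.filter fun b => s b < s t).eq_empty_or_nonempty with h0 | h0
  · simp [h0]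
  obtain ⟨u, hu, humax⟩ := Finset.exists_max_image _ s h0
  rw [Finset.mem_filter] at hu
  have hu' : ¬ B.card ≤ 2 * (B.filter fun b => s b ≤ s u).card := fun h =>
    absurd (hmin u (Finset.mem_filter.mpr ⟨hu.1, h⟩)) (not_le.mpr hu.2)
  have : (B.filter fun b => s b < s t).card ≤ (B.filter fun b => s b ≤ s u).card := by
    refine Finset.card_le_card fun b hb => ?_
    exact Finset.mem_filter.mpr ⟨(Finset.mem_filter.mp hb).1, humax b hb⟩
  omega

/-- Every function `F b`, `b ∈ B`, has a constant sign on `A`. -/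
def SignHomogeneous {α β : Type} (F : β → α → ℝ) (A : Finset α) (B : Finset β) : Prop :=
  ∀ b ∈ B, ∃ s : SignType, ∀ a ∈ A, SignType.sign (F b a) = s

/-- The matrix `F`, restricted to the rows in `B`, is a sum of `k` matrices of rank one. -/
def RankLE {α β : Type} (k : ℕ) (B : Finset β) (F : β → α → ℝ) : Prop :=
  ∃ (u : β → Fin k → ℝ) (v : α → Fin k → ℝ), ∀ b ∈ B, ∀ a, F b a = ∑ i, u b i * v a i

/-- Every real matrix of rank at most `k` has a submatrix with sign-homogeneous rows that contains
the fraction `c` of its rows and of its columns. -/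
def HomogeneousFraction (k : ℕ) (c : ℝ) : Prop :=
  ∀ (α β : Type) (A : Finset α) (B : Finset β) (F : β → α → ℝ), RankLE k B F →
    ∃ A' ⊆ A, ∃ B' ⊆ B, c * A.card ≤ A'.card ∧ c * B.card ≤ B'.card ∧ SignHomogeneous F A' B'

theorem RankLE.mono {α β : Type} {k : ℕ} {B B' : Finset β} {F : β → α → ℝ} (h : RankLE k B F)
    (hB : B' ⊆ B) : RankLE k B' F := by
  obtain ⟨u, v, h⟩ := h
  exact ⟨u, v, fun b hb => h b (hB hb)⟩

theorem RankLE.of_coeff_eq_zero {α β : Type} {k : ℕ} {B : Finset β} {F : β → α → ℝ}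
    (u : β → Fin (k + 1) → ℝ) (v : α → Fin (k + 1) → ℝ)
    (h : ∀ b ∈ B, ∀ a, F b a = ∑ i, u b i * v a i) (j : Fin (k + 1)) (h0 : ∀ b ∈ B, u b j = 0) :
    RankLE k B F := by
  refine ⟨fun b i => u b (j.succAbove i), fun a i => v a (j.succAbove i), fun b hb a => ?_⟩
  rw [h b hb a, Fin.sum_univ_succAbove _ j, h0 b hb, zero_mul, zero_add]

theorem HomogeneousFraction.of_subset {k : ℕ} {c : ℝ} (hc : HomogeneousFraction k c)
    {α β : Type} (A : Finset α) {B B₀ : Finset β} (hB : B₀ ⊆ B) {F : β → α → ℝ}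
    (hF : RankLE k B₀ F) :
    ∃ A' ⊆ A, ∃ B' ⊆ B, c * A.card ≤ A'.card ∧ c * B₀.card ≤ B'.card ∧
      SignHomogeneous F A' B' := by
  obtain ⟨A', hA', B', hB', h⟩ := hc α β A B₀ F hF
  exact ⟨A', hA', B', hB'.trans hB, h⟩

theorem exists_sign_fraction {α : Type*} (A : Finset α) (f : α → ℝ) :
    ∃ A' ⊆ A, (1 / 3 : ℝ) * A.card ≤ A'.card ∧ ∃ s : SignType, ∀ a ∈ A', SignType.sign (f a) = s := by
  classical
  by_contra! hc
  have h : ∀ s : SignType, ((A.filter fun a => SignType.sign (f a) = s).card : ℝ)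
      < 1 / 3 * A.card := by
    intro s
    by_contra! hs
    obtain ⟨a, ha, hne⟩ := hc _ (Finset.filter_subset _ _) hs s
    exact hne (Finset.mem_filter.mp ha).2
  have hsum : A.card = ∑ s : SignType, (A.filter fun a => SignType.sign (f a) = s).card :=
    Finset.card_eq_sum_card_fiberwise fun a _ => Finset.mem_coe.mpr (Finset.mem_univ _)
  have h3 : ∑ s : SignType, ((A.filter fun a => SignType.sign (f a) = s).card : ℝ)
      < ∑ s : SignType, (1 / 3 : ℝ) * A.card :=
    Finset.sum_lt_sum_of_nonempty Finset.univ_nonempty fun s _ => h s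
  have h4 : (Finset.univ : Finset SignType).card = 3 := rfl
  rw [Finset.sum_const, h4, ← Nat.cast_sum, ← hsum] at h3
  norm_num at h3
  linarith

theorem homogeneousFraction_one : HomogeneousFraction 1 (1 / 3) := by
  rintro α β A B F ⟨u, v, h⟩
  obtain ⟨A', hA', hcard, s, hs⟩ := exists_sign_fraction A fun a => v a 0
  refine ⟨A', hA', B, subset_rfl, hcard, ?_, fun b hb => ⟨SignType.sign (u b 0) * s, ?_⟩⟩
  · have : (0 : ℝ) ≤ B.card := by positivity
    linarith
  · intro a ha
    simp [h b hb a, sign_mul, hs a ha]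

/-- The sign of a positive multiple `x` of a positive combination of `y` and `z` is determined by
the signs of `y` and `z`, unless these are opposite. -/
theorem sign_eq_of_mul_eq {x y z t p q : ℝ} (ht : 0 < t) (hp : 0 < p) (hq : 0 < q)
    (h : t * x = p * y + q * z) (hyz : SignType.sign y * SignType.sign z ≠ -1) :
    SignType.sign x = if SignType.sign y = 0 then SignType.sign z else SignType.sign y := by
  have h1 : SignType.sign x = SignType.sign (p * y + q * z) := by
    rw [← h, sign_mul, sign_pos ht, one_mul]
  rw [h1]
  rcases lt_trichotomy y 0 with hy | hy | hy
  · rcases lt_trichotomy z 0 with hz | hz | hz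
    · rw [sign_neg hy, sign_neg (by nlinarith)]; rfl
    · rw [hz, sign_neg hy, sign_neg (by nlinarith)]; rfl
    · rw [sign_neg hy, sign_pos hz] at hyz; exact absurd rfl hyz
  · rw [hy, mul_zero, zero_add, sign_mul, sign_pos hq, one_mul, sign_zero, if_pos rfl]
  · rcases lt_trichotomy z 0 with hz | hz | hz
    · rw [sign_pos hy, sign_neg hz] at hyz; exact absurd rfl hyz
    · rw [hz, sign_pos hy, sign_pos (by nlinarith)]; rfl
    · rw [sign_pos hy, sign_pos (by nlinarith)]; rfl

theorem exists_injOn_mapsTo_of_card_le {β : Type*} {S T : Finset β} (h : S.card ≤ T.card) :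
    ∃ e : β → β, Set.InjOn e S ∧ ∀ b ∈ S, e b ∈ T := by
  classical
  obtain ⟨T', hT', hcard⟩ := Finset.exists_subset_card_eq h
  let f := Finset.equivOfCardEq hcard.symm
  refine ⟨fun b => if hb : b ∈ S then f ⟨b, hb⟩ else b, ?_, ?_⟩
  · intro a ha b hb hab
    have ha' : a ∈ S := ha
    have hb' : b ∈ S := hb
    simp only [ha', hb', dif_pos] at hab
    simpa using f.injective (Subtype.ext hab)
  · intro b hb
    simp only [hb, dif_pos]
    exact hT' (f ⟨b, hb⟩).2

theorem HomogeneousFraction.of_pairing {k : ℕ} {c : ℝ} (hc0 : 0 < c)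
    (hc : HomogeneousFraction (k + 1) c) {α β : Type} (A : Finset α) {B D : Finset β}
    {F : β → α → ℝ} (u : β → Fin (k + 2) → ℝ) (v : α → Fin (k + 2) → ℝ)
    (h : ∀ b ∈ B, ∀ a, F b a = ∑ i, u b i * v a i) (hpos : ∀ b ∈ B, 0 < u b 0)
    (hD : D ⊆ B) (e : β → β) (he : Set.InjOn e D) (heB : ∀ b ∈ D, e b ∈ B)
    (hopp : ∀ b ∈ D, u b 1 * u (e b) 1 < 0) :
    ∃ A' ⊆ A, ∃ B' ⊆ B, c ^ 2 * A.card ≤ A'.card ∧ c ^ 2 / 2 * D.card ≤ B'.card ∧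
      SignHomogeneous F A' B' := by
  classical
  set Fα : β → α → ℝ := fun b a => |u (e b) 1| * F b a + |u b 1| * F (e b) a with hFα
  set Fβ : β → α → ℝ := fun b a => u (e b) 0 * F b a - u b 0 * F (e b) a with hFβ
  have hα : RankLE (k + 1) D Fα := by
    refine RankLE.of_coeff_eq_zero (fun b i => |u (e b) 1| * u b i + |u b 1| * u (e b) i) v
      (fun b hb a => ?_) 1 fun b hb => ?_
    · simp only [hFα, h b (hD hb), h (e b) (heB b hb), Finset.mul_sum, ← Finset.sum_add_distrib]
      exact Finset.sum_congr rfl fun i _ => by ring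
    · rcases mul_neg_iff.mp (hopp b hb) with ⟨h1, h2⟩ | ⟨h1, h2⟩
      · simp only [abs_of_pos h1, abs_of_neg h2]; ring
      · simp only [abs_of_pos h2, abs_of_neg h1]; ring
  have hβ : RankLE (k + 1) D Fβ := by
    refine RankLE.of_coeff_eq_zero (fun b i => u (e b) 0 * u b i - u b 0 * u (e b) i) v
      (fun b hb a => ?_) 0 fun b hb => by ring
    simp only [hFβ, h b (hD hb), h (e b) (heB b hb), Finset.mul_sum, ← Finset.sum_sub_distrib]
    exact Finset.sum_congr rfl fun i _ => by ring
  obtain ⟨A₁, hA₁, D₁, hD₁, hA₁c, hD₁c, hs₁⟩ := hc α β A D Fα hα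
  obtain ⟨A₂, hA₂, D₂, hD₂, hA₂c, hD₂c, hs₂⟩ := hc α β A₁ D₁ Fβ (hβ.mono hD₁)
  -- `F b` is a positive combination of `Fα b` and `Fβ b`, and `F (e b)` one of `Fα b` and `-Fβ b`.
  -- Only opposite nonzero signs block the first, and then the second works.
  have hrow : ∀ b ∈ D₂, (∃ s : SignType, ∀ a ∈ A₂, SignType.sign (F b a) = s) ∨
      ∃ s : SignType, ∀ a ∈ A₂, SignType.sign (F (e b) a) = s := by
    intro b hb
    have hbD := hD₁ (hD₂ hb)
    obtain ⟨s, hs⟩ := hs₁ b (hD₂ hb)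
    obtain ⟨s', hs'⟩ := hs₂ b hb
    have hp := hpos b (hD hbD)
    have hp' := hpos (e b) (heB b hbD)
    have hq : 0 < |u b 1| := abs_pos.mpr (left_ne_zero_of_mul (hopp b hbD).ne)
    have hq' : 0 < |u (e b) 1| := abs_pos.mpr (right_ne_zero_of_mul (hopp b hbD).ne)
    have ht : 0 < u b 0 * |u (e b) 1| + |u b 1| * u (e b) 0 := by positivity
    by_cases hss : s * s' = -1
    · refine Or.inr ⟨if s = 0 then -s' else s, fun a ha => ?_⟩
      have key := sign_eq_of_mul_eq (x := F (e b) a) (y := Fα b a) (z := -Fβ b a) ht hp' hq'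
        (by simp only [hFα, hFβ]; ring)
      rw [Left.sign_neg, hs a (hA₂ ha), hs' a ha] at key
      refine key ?_
      revert hss; clear * -; revert s s'; decide
    · refine Or.inl ⟨if s = 0 then s' else s, fun a ha => ?_⟩
      have key := sign_eq_of_mul_eq (x := F b a) (y := Fα b a) (z := Fβ b a) ht hp hq
        (by simp only [hFα, hFβ]; ring)
      rw [hs a (hA₂ ha), hs' a ha] at key
      exact key hss
  have hAcard : c ^ 2 * A.card ≤ A₂.card := by
    have := mul_le_mul_of_nonneg_left hA₁c hc0.le
    nlinarith
  have hDcard : c ^ 2 * D.card ≤ D₂.card := by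
    have := mul_le_mul_of_nonneg_left hD₁c hc0.le
    nlinarith
  set X := D₂.filter fun b => ∃ s : SignType, ∀ a ∈ A₂, SignType.sign (F b a) = s
  set Y := D₂.filter fun b => ∃ s : SignType, ∀ a ∈ A₂, SignType.sign (F (e b) a) = s
  have hXY : D₂.card ≤ X.card + Y.card := by
    refine le_trans (Finset.card_le_card fun b hb => ?_) (Finset.card_union_le X Y)
    rw [Finset.mem_union, Finset.mem_filter, Finset.mem_filter]
    exact (hrow b hb).imp (⟨hb, ·⟩) (⟨hb, ·⟩)
  have hXY' : (D₂.card : ℝ) ≤ X.card + Y.card := by exact_mod_cast hXY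
  have hYD : ∀ b ∈ Y, b ∈ D := fun b hb => hD₁ (hD₂ (Finset.mem_filter.mp hb).1)
  -- Keep whichever member of the pair is good more often; this costs the factor 2 in `c ^ 2 / 2`.
  rcases le_total (Y.card : ℝ) X.card with hle | hle
  · refine ⟨A₂, hA₂.trans hA₁, X, fun b hb => hD (hD₁ (hD₂ (Finset.mem_filter.mp hb).1)), hAcard,
      by linarith, fun b hb => (Finset.mem_filter.mp hb).2⟩
  · refine ⟨A₂, hA₂.trans hA₁, Y.image e, ?_, hAcard, ?_, ?_⟩
    · intro b hb
      obtain ⟨b, hbY, rfl⟩ := Finset.mem_image.mp hb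
      exact heB b (hYD b hbY)
    · rw [Finset.card_image_of_injOn (he.mono hYD)]
      linarith
    · intro b hb
      obtain ⟨b, hbY, rfl⟩ := Finset.mem_image.mp hb
      exact (Finset.mem_filter.mp hbY).2

/-- A change of basis centred at a median makes coefficient 1 change sign in a balanced way: either
a quarter of the rows lose this coefficient, so that the rank drops, or there are a quarter of each
sign to pair up. -/
theorem HomogeneousFraction.of_pos {k : ℕ} {c : ℝ} (hc0 : 0 < c) (hc1 : c ≤ 1)
    (hc : HomogeneousFraction (k + 1) c) {α β : Type} (A : Finset α) (B : Finset β)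
    {F : β → α → ℝ} (u : β → Fin (k + 2) → ℝ) (v : α → Fin (k + 2) → ℝ)
    (h : ∀ b ∈ B, ∀ a, F b a = ∑ i, u b i * v a i) (hpos : ∀ b ∈ B, 0 < u b 0) :
    ∃ A' ⊆ A, ∃ B' ⊆ B, c ^ 2 * A.card ≤ A'.card ∧ c ^ 2 / 8 * B.card ≤ B'.card ∧
      SignHomogeneous F A' B' := by
  classical
  have hsq : c ^ 2 ≤ c := by nlinarith
  rcases B.eq_empty_or_nonempty with rfl | hB
  · exact ⟨A, subset_rfl, ∅, subset_rfl,
      mul_le_of_le_one_left (Nat.cast_nonneg _) (hsq.trans hc1), by simp,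
      fun b hb => absurd hb (Finset.notMem_empty b)⟩
  obtain ⟨m, hm1, hm2⟩ := exists_median B hB fun b => u b 1 / u b 0
  -- The sign of the new coefficient 1 compares `u b 1 / u b 0` with `m`; the change in `v'`
  -- compensates.
  set u' : β → Fin (k + 2) → ℝ := fun b i => if i = 1 then u b 1 - m * u b 0 else u b i with hu'
  set v' : α → Fin (k + 2) → ℝ := fun a i => if i = 0 then v a 0 + m * v a 1 else v a i with hv'
  have h01 : (0 : Fin (k + 2)) ≠ 1 := by simp
  have h' : ∀ b ∈ B, ∀ a, F b a = ∑ i, u' b i * v' a i := by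
    intro b hb a
    rw [h b hb a, Fin.sum_univ_succ, Fin.sum_univ_succ, Fin.sum_univ_succ, Fin.sum_univ_succ]
    have h1 : ∀ i : Fin k, i.succ.succ ≠ (1 : Fin (k + 2)) := fun i hi => by
      simp [Fin.ext_iff] at hi
    simp [hu', hv', h1]
    ring
  have hu0 : ∀ b, u' b 0 = u b 0 := fun b => by simp [hu', h01]
  have hu1 : ∀ b, u' b 1 = u b 1 - m * u b 0 := fun b => by simp [hu']
  have hpos' : ∀ b ∈ B, 0 < u' b 0 := fun b hb => by rw [hu0]; exact hpos b hb
  set Z := B.filter fun b => u' b 1 = 0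
  set N := B.filter fun b => u' b 1 < 0
  set S := B.filter fun b => 0 < u' b 1
  have hNm : (B.filter fun b => u b 1 / u b 0 < m) = N := by
    refine Finset.filter_congr fun b hb => ?_
    rw [div_lt_iff₀ (hpos b hb), hu1, sub_neg]
  have hle : (B.filter fun b => u b 1 / u b 0 ≤ m).card ≤ N.card + Z.card := by
    refine le_trans (Finset.card_le_card fun b hb => ?_) (Finset.card_union_le N Z)
    obtain ⟨hb, hbm⟩ := Finset.mem_filter.mp hb
    rw [div_le_iff₀ (hpos b hb), ← sub_nonpos, ← hu1] at hbm
    rw [Finset.mem_union, Finset.mem_filter, Finset.mem_filter]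
    exact hbm.lt_or_eq.imp (⟨hb, ·⟩) (⟨hb, ·⟩)
  have hall : B.card ≤ N.card + Z.card + S.card := by
    refine le_trans (Finset.card_le_card fun b hb => ?_)
      ((Finset.card_union_le (N ∪ Z) S).trans (Nat.add_le_add_right (Finset.card_union_le N Z) _))
    simp only [Finset.mem_union, Finset.mem_filter, N, Z, S]
    rcases lt_trichotomy (u' b 1) 0 with hb1 | hb1 | hb1
    exacts [Or.inl (Or.inl ⟨hb, hb1⟩), Or.inl (Or.inr ⟨hb, hb1⟩), Or.inr ⟨hb, hb1⟩]
  rw [hNm] at hm2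
  by_cases hZ : B.card ≤ 4 * Z.card
  · obtain ⟨A', hA', B', hB', hAc, hBc, hs⟩ := hc.of_subset A (Finset.filter_subset _ B)
      (RankLE.of_coeff_eq_zero u' v' (fun b hb => h' b (Finset.mem_filter.mp hb).1) 1
        fun b hb => (Finset.mem_filter.mp hb).2)
    have hZ' : (B.card : ℝ) ≤ 4 * Z.card := by exact_mod_cast hZ
    refine ⟨A', hA', B', hB', ?_, ?_, hs⟩
    · exact (mul_le_mul_of_nonneg_right hsq (Nat.cast_nonneg _)).trans hAc
    · refine le_trans ?_ hBc
      have h1 : c ^ 2 / 8 * B.card ≤ c / 8 * (4 * Z.card) := by gcongr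
      have h2 : (0 : ℝ) ≤ c * Z.card := mul_nonneg hc0.le (Nat.cast_nonneg _)
      linarith
  · have hN4 : B.card ≤ 4 * N.card := by omega
    have hS4 : B.card ≤ 4 * S.card := by omega
    have hN4' : (B.card : ℝ) ≤ 4 * N.card := by exact_mod_cast hN4
    have hS4' : (B.card : ℝ) ≤ 4 * S.card := by exact_mod_cast hS4
    have hfin : ∀ D : Finset β, (B.card : ℝ) ≤ 4 * D.card →
        c ^ 2 / 8 * B.card ≤ c ^ 2 / 2 * D.card := fun D hD => by nlinarith [sq_nonneg c]
    rcases le_total N.card S.card with hNS | hNS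
    · obtain ⟨e, he, heS⟩ := exists_injOn_mapsTo_of_card_le hNS
      obtain ⟨A', hA', B', hB', hAc, hBc, hs⟩ := hc.of_pairing hc0 A u' v' h' hpos'
        (Finset.filter_subset _ B) e he (fun b hb => (Finset.mem_filter.mp (heS b hb)).1)
        fun b hb => mul_neg_of_neg_of_pos (Finset.mem_filter.mp hb).2
          (Finset.mem_filter.mp (heS b hb)).2
      exact ⟨A', hA', B', hB', hAc, (hfin N hN4').trans hBc, hs⟩
    · obtain ⟨e, he, heN⟩ := exists_injOn_mapsTo_of_card_le hNS
      obtain ⟨A', hA', B', hB', hAc, hBc, hs⟩ := hc.of_pairing hc0 A u' v' h' hpos'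
        (Finset.filter_subset _ B) e he (fun b hb => (Finset.mem_filter.mp (heN b hb)).1)
        fun b hb => mul_neg_of_pos_of_neg (Finset.mem_filter.mp hb).2
          (Finset.mem_filter.mp (heN b hb)).2
      exact ⟨A', hA', B', hB', hAc, (hfin S hS4').trans hBc, hs⟩

/-- Coefficient 0 has constant sign on a third of the rows. Sign 0 lowers the rank, and a negative
sign becomes positive on passing to `-F`. The constant is `1 / 24 = 1 / 3 * 1 / 8`. -/
theorem HomogeneousFraction.succ {k : ℕ} {c : ℝ} (hc0 : 0 < c) (hc1 : c ≤ 1)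
    (hc : HomogeneousFraction (k + 1) c) : HomogeneousFraction (k + 2) (c ^ 2 / 24) := by
  rintro α β A B F ⟨u, v, h⟩
  obtain ⟨B₀, hB₀, hcard, s, hs⟩ := exists_sign_fraction B fun b => u b 0
  have hsq : c ^ 2 ≤ c := by nlinarith
  have hA0 : (0 : ℝ) ≤ c ^ 2 * A.card := by positivity
  have hfrac : c ^ 2 / 24 * B.card ≤ c ^ 2 / 8 * B₀.card := by nlinarith [sq_nonneg c]
  have h₀ : ∀ b ∈ B₀, ∀ a, F b a = ∑ i, u b i * v a i := fun b hb => h b (hB₀ hb)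
  rcases s.trichotomy with rfl | rfl | rfl
  · obtain ⟨A', hA', B', hB', hAc, hBc, hsign⟩ := hc.of_pos hc0 hc1 A B₀
      (F := fun b a => -F b a) (fun b i => -u b i) v
      (fun b hb a => by simp [h₀ b hb a]) fun b hb => by simpa using sign_eq_neg_one_iff.mp (hs b hb)
    refine ⟨A', hA', B', hB'.trans hB₀, by linarith, by linarith, fun b hb => ?_⟩
    obtain ⟨s, hs⟩ := hsign b hb
    exact ⟨-s, fun a ha => by rw [← hs a ha, Left.sign_neg, neg_neg]⟩
  · obtain ⟨A', hA', B', hB', hAc, hBc, hsign⟩ := hc.of_subset A hB₀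
      (RankLE.of_coeff_eq_zero u v h₀ 0 fun b hb => sign_eq_zero_iff.mp (hs b hb))
    refine ⟨A', hA', B', hB', ?_, ?_, hsign⟩
    · have := mul_le_mul_of_nonneg_right hsq (Nat.cast_nonneg (α := ℝ) A.card)
      linarith
    · have := mul_le_mul_of_nonneg_right hsq (Nat.cast_nonneg (α := ℝ) B₀.card)
      have : (0 : ℝ) ≤ c ^ 2 * B₀.card := by positivity
      linarith
  · obtain ⟨A', hA', B', hB', hAc, hBc, hsign⟩ := hc.of_pos hc0 hc1 A B₀ u v h₀
      fun b hb => sign_eq_one_iff.mp (hs b hb)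
    exact ⟨A', hA', B', hB'.trans hB₀, by linarith, by linarith, hsign⟩

/-- Matrices of bounded rank have sign-homogeneous submatrices of positive fractional size. -/
theorem exists_homogeneousFraction (k : ℕ) :
    ∃ c : ℝ, 0 < c ∧ c ≤ 1 ∧ HomogeneousFraction (k + 1) c := by
  induction k with
  | zero => exact ⟨1 / 3, by norm_num, by norm_num, homogeneousFraction_one⟩
  | succ k ih =>
    obtain ⟨c, hc0, hc1, hc⟩ := ih
    exact ⟨c ^ 2 / 24, by positivity, by nlinarith, hc.succ hc0 hc1⟩

/-! ### Distances as signs of matrices of rank at most 4. -/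

theorem rankLE_const {α β : Type} (k : ℕ) (B : Finset β) (r : ℝ) :
    RankLE (k + 1) B (fun (_ : β) (_ : α) => r) :=
  ⟨fun _ i => if i = 0 then r else 0, fun _ _ => 1, fun b _ a => by simp⟩

/-- For a radius `r ≥ 0`, expanding `‖a - b‖ ^ 2 - r ^ 2` separates `a` from `b` in four products.
For infinite or negative `t` the comparison is constant. -/
theorem exists_rankLE_dist_le (t : EReal) :
    ∃ F : Plane → Plane → ℝ, (∀ B, RankLE 4 B F) ∧
      ∀ b a, ((dist a b : ℝ) : EReal) ≤ t ↔ F b a ≤ 0 := by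
  induction t with
  | bot => exact ⟨_, fun B => rankLE_const 3 B 1, fun b a => by simp⟩
  | top => exact ⟨_, fun B => rankLE_const 3 B (-1), fun b a => by simp⟩
  | coe r =>
    rcases lt_or_ge r 0 with hr | hr
    · refine ⟨_, fun B => rankLE_const 3 B 1, fun b a => ?_⟩
      rw [EReal.coe_le_coe_iff]
      have : (0 : ℝ) ≤ dist a b := dist_nonneg
      constructor <;> intro h <;> linarith
    · refine ⟨fun b a => dist a b ^ 2 - r ^ 2, fun B =>
        ⟨fun b => ![1, -2 * b 0, -2 * b 1, b 0 ^ 2 + b 1 ^ 2 - r ^ 2],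
          fun a => ![a 0 ^ 2 + a 1 ^ 2, a 0, a 1, 1], fun b _ a => ?_⟩, fun b a => ?_⟩
      · change dist a b ^ 2 - r ^ 2 = _
        rw [EuclideanSpace.dist_eq, Real.sq_sqrt (by positivity)]
        simp [Fin.sum_univ_succ, Real.dist_eq]
        ring
      · rw [EReal.coe_le_coe_iff, sub_nonpos, sq_le_sq₀ dist_nonneg hr]

theorem SignHomogeneous.nonpos_iff {α β : Type} {F : β → α → ℝ} {A : Finset α} {B : Finset β}
    (h : SignHomogeneous F A B) {b : β} (hb : b ∈ B) {a a' : α} (ha : a ∈ A) (ha' : a' ∈ A) :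
    F b a ≤ 0 ↔ F b a' ≤ 0 := by
  obtain ⟨s, hs⟩ := h b hb
  rw [← not_lt, ← not_lt, ← sign_eq_one_iff, ← sign_eq_one_iff, hs a ha, hs a' ha']

/-- For every interval, a positive fraction of `A` and a positive fraction of `B` are such that for
each point of the latter either all or none of its distances to the former are in the interval. -/
theorem exists_homogeneous_interval :
    ∃ c : ℝ, 0 < c ∧ c ≤ 1 ∧ ∀ (J : Interval) (A B : Finset Plane),
      ∃ A' ⊆ A, ∃ B' ⊆ B, c * A.card ≤ A'.card ∧ c * B.card ≤ B'.card ∧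
        ∀ b ∈ B', (∀ a ∈ A', dist a b ∈ J.toSet) ∨ ∀ a ∈ A', dist a b ∉ J.toSet := by
  obtain ⟨c, hc0, hc1, hc⟩ := exists_homogeneousFraction 3
  -- One factor `c` for each bounding circle of the annulus.
  refine ⟨c ^ 2, by positivity, by nlinarith, fun J A B => ?_⟩
  obtain ⟨F, hF, hFle⟩ := exists_rankLE_dist_le J.lo
  obtain ⟨F', hF', hFle'⟩ := exists_rankLE_dist_le J.hi
  obtain ⟨A₁, hA₁, B₁, hB₁, hA₁c, hB₁c, hs₁⟩ := hc _ _ A B F (hF B)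
  obtain ⟨A₂, hA₂, B₂, hB₂, hA₂c, hB₂c, hs₂⟩ := hc _ _ A₁ B₁ F' (hF' B₁)
  refine ⟨A₂, hA₂.trans hA₁, B₂, hB₂.trans hB₁, ?_, ?_, fun b hb => ?_⟩
  · have := mul_le_mul_of_nonneg_left hA₁c hc0.le
    linarith
  · have := mul_le_mul_of_nonneg_left hB₁c hc0.le
    linarith
  have hiff : ∀ a ∈ A₂, ∀ a' ∈ A₂, (dist a b ∈ J.toSet ↔ dist a' b ∈ J.toSet) := by
    intro a ha a' ha'
    simp only [Interval.toSet, Set.mem_ofPred_eq]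
    rw [← not_le, ← not_le, hFle, hFle, hFle', hFle', hs₁.nonpos_iff (hB₂ hb) (hA₂ ha) (hA₂ ha'),
      hs₂.nonpos_iff hb ha ha']
  by_cases h : ∃ a ∈ A₂, dist a b ∈ J.toSet
  · obtain ⟨a, ha, hJ⟩ := h
    exact Or.inl fun a' ha' => (hiff a ha a' ha').mp hJ
  · push Not at h
    exact Or.inr h

/-! ### The dichotomy for a single expander. -/

/-- To be used with `s = √d`, `M = |A| + |B|`, `N = |A ∪ B|` and `z` the root of the product of the
sizes of the two vertex sets. Since `s * z ≥ 3 * M`, the main term is at least `3 * s * z` and the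
error at most `2 * s * z`. -/
theorem le_mixing_bound {M N s z c : ℝ} (hN0 : 0 < N) (hN : N ≤ M) (hs0 : 0 ≤ s) (hc0 : 0 < c)
    (hs : 15 ≤ s * c) (hz : c / 5 * M ≤ z) :
    M ≤ s ^ 2 * z ^ 2 / N - 2 * Real.sqrt (s ^ 2 - 1) * z := by
  have hM0 : 0 < M := hN0.trans_le hN
  have hz0 : 0 ≤ z := le_trans (by positivity) hz
  have h1 : s ^ 2 * z ^ 2 / M ≤ s ^ 2 * z ^ 2 / N := by gcongr
  have h2 : Real.sqrt (s ^ 2 - 1) ≤ s := by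
    rw [Real.sqrt_le_left hs0]; linarith
  have h3 : 2 * Real.sqrt (s ^ 2 - 1) * z ≤ 2 * s * z := by gcongr
  have hsz : 3 * M ≤ s * z := by
    have h5 : s * (c / 5 * M) ≤ s * z := by gcongr
    have h6 : 15 * M ≤ s * c * M := by gcongr
    linarith
  have h4 : 3 * (s * z) ≤ s ^ 2 * z ^ 2 / M := by
    rw [le_div_iff₀ hM0]
    have := mul_le_mul_of_nonneg_left hsz (mul_nonneg hs0 hz0)
    linarith
  linarith

open Classical in
/-- If `W` is an expander on the union of `A` and `B`, then either a positive fraction of the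
pairs in `A × B` have their distance outside `J`, or the edges of `W` with their distance in `J`
have large weight. -/
theorem card_mul_card_le_of_expander :
    ∃ (η : ℝ) (d₀ : ℕ), 0 < η ∧ η ≤ 1 ∧ ∀ d ≥ d₀, ∀ (A B : Finset Plane) (J : Interval)
      (W : Plane → Plane → ℕ), B.card ≤ A.card → A.card < 2 * B.card →
      IsLPSExpander d (A ∪ B) W →
      (A.card * B.card : ℝ) ≤ (∑ a ∈ A, ∑ b ∈ B, if dist a b ∈ J.toSet then 0 else 1) / η
        + ∑ a ∈ A, ∑ b ∈ B, if dist a b ∈ J.toSet then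
          (W a b : ℝ) * ((A.card : ℝ) * B.card / ((A.card : ℝ) + B.card)) else 0 := by
  obtain ⟨c, hc0, hc1, hc⟩ := exists_homogeneous_interval
  refine ⟨c ^ 2 / 2, ⌈(15 / c) ^ 2⌉₊, by positivity, by nlinarith, ?_⟩
  intro d hd A B J W hBA hAB hW
  have hB0 : (0 : ℝ) < B.card := by exact_mod_cast (by omega : 0 < B.card)
  have hA0 : (0 : ℝ) < A.card := by exact_mod_cast (by omega : 0 < A.card)
  have hBA' : (B.card : ℝ) ≤ A.card := by exact_mod_cast hBA
  have hAB' : (A.card : ℝ) ≤ 2 * B.card := by exact_mod_cast hAB.le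
  set w : ℝ := (A.card : ℝ) * B.card / ((A.card : ℝ) + B.card) with hw
  have hw0 : 0 < w := by positivity
  set q : ℝ := ∑ a ∈ A, ∑ b ∈ B, if dist a b ∈ J.toSet then 0 else 1 with hq
  have hf0 : ∀ a b, (0 : ℝ) ≤ if dist a b ∈ J.toSet then (W a b : ℝ) * w else 0 := by
    intro a b; split_ifs <;> positivity
  have hg0 : ∀ a b : Plane, (0 : ℝ) ≤ if dist a b ∈ J.toSet then 0 else 1 := by
    intro a b; split_ifs <;> norm_num
  have hmono : ∀ (f : Plane → Plane → ℝ), (∀ a b, 0 ≤ f a b) → ∀ A' ⊆ A, ∀ B' ⊆ B,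
      ∑ a ∈ A', ∑ b ∈ B', f a b ≤ ∑ a ∈ A, ∑ b ∈ B, f a b := by
    intro f hf A' hA' B' hB'
    refine (Finset.sum_le_sum fun a _ =>
      Finset.sum_le_sum_of_subset_of_nonneg hB' fun b _ _ => hf a b).trans ?_
    exact Finset.sum_le_sum_of_subset_of_nonneg hA' fun a _ _ => Finset.sum_nonneg fun b _ => hf a b
  by_cases hqη : c ^ 2 / 2 * (A.card * B.card) ≤ q
  · have h1 : (A.card * B.card : ℝ) ≤ q / (c ^ 2 / 2) := by
      rw [le_div_iff₀ (by positivity)]; linarith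
    have h2 := Finset.sum_nonneg fun a (_ : a ∈ A) => Finset.sum_nonneg fun b (_ : b ∈ B) => hf0 a b
    linarith
  push Not at hqη
  obtain ⟨A', hA', B', hB', hA'c, hB'c, hhom⟩ := hc J A B
  set X := B'.filter fun b => ∀ a ∈ A', dist a b ∈ J.toSet with hX
  set Y := B'.filter fun b => ¬ ∀ a ∈ A', dist a b ∈ J.toSet with hY
  have hXY : (X.card : ℝ) + Y.card = B'.card := by
    exact_mod_cast Finset.card_filter_add_card_filter_not _
  have hYq : (A'.card : ℝ) * Y.card ≤ q := by
    refine le_trans (le_of_eq ?_) (hmono _ hg0 A' hA' Y ((Finset.filter_subset _ _).trans hB'))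
    have : ∀ a ∈ A', ∀ b ∈ Y, (if dist a b ∈ J.toSet then (0 : ℝ) else 1) = 1 := by
      intro a ha b hb
      obtain ⟨hb, hne⟩ := Finset.mem_filter.mp hb
      exact if_neg ((hhom b hb).resolve_left hne a ha)
    rw [Finset.sum_congr rfl fun a ha => Finset.sum_congr rfl (this a ha)]
    simp
  -- All pairs of `A' × Y` are lost and `|A'| ≥ c * |A|`, so a larger `Y` would contradict `hqη`.
  -- This is why the threshold is `c ^ 2 / 2`.
  have hYc : (Y.card : ℝ) ≤ c / 2 * B.card := by
    have h1 : c * A.card * Y.card ≤ A'.card * Y.card := by gcongr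
    have h2 : c * A.card * Y.card ≤ c * A.card * (c / 2 * B.card) := by linarith
    exact le_of_mul_le_mul_left h2 (by positivity)
  have hXc : c / 2 * B.card ≤ X.card := by linarith
  have hA'0 : (0 : ℝ) ≤ A'.card := Nat.cast_nonneg _
  have hy : c ^ 2 / 2 * (A.card * B.card) ≤ (A'.card : ℝ) * X.card := by
    calc c ^ 2 / 2 * ((A.card : ℝ) * B.card) = (c * A.card) * (c / 2 * B.card) := by ring
      _ ≤ _ := by gcongr
  set M : ℝ := (A.card : ℝ) + B.card with hM
  have hM0 : 0 < M := by positivity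
  set z := Real.sqrt ((A'.card : ℝ) * X.card) with hz
  have hz2 : z ^ 2 = (A'.card : ℝ) * X.card := Real.sq_sqrt (by positivity)
  -- Balance of the block gives `M ^ 2 ≤ 9 * |A| * |B|`, so `z ^ 2 ≥ c ^ 2 * M ^ 2 / 18`, and `18 ≤
  -- 5 ^ 2`.
  have hzM : c / 5 * M ≤ z := by
    refine Real.le_sqrt_of_sq_le (le_trans ?_ hy)
    have hM2 : M ^ 2 ≤ 9 * (A.card * B.card) := by
      have : M ≤ 3 * B.card := by linarith
      have h1 : M * M ≤ (3 * B.card) * (3 * B.card) := by gcongr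
      have h2 : (B.card : ℝ) * B.card ≤ A.card * B.card := by gcongr
      linarith
    have := mul_le_mul_of_nonneg_left hM2 (sq_nonneg c)
    have h0 : 0 ≤ c ^ 2 * M ^ 2 := by positivity
    linarith
  set s := Real.sqrt d with hs
  have hs2 : s ^ 2 = d := Real.sq_sqrt (Nat.cast_nonneg _)
  have hs15 : 15 ≤ s * c := by
    rw [← div_le_iff₀ hc0]
    exact Real.le_sqrt_of_sq_le ((Nat.le_ceil _).trans (by exact_mod_cast hd))
  have hs0 : 0 ≤ s := Real.sqrt_nonneg _
  have hmix := hW.le_sum_sum (hA'.trans Finset.subset_union_left)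
    (((Finset.filter_subset _ _).trans hB').trans Finset.subset_union_right : X ⊆ A ∪ B)
  rw [← hz, ← hz2, ← hs2] at hmix
  have hN : ((A ∪ B).card : ℝ) ≤ M := by
    rw [hM]; exact_mod_cast Finset.card_union_le A B
  have hN0 : (0 : ℝ) < ((A ∪ B).card : ℝ) := by
    exact_mod_cast lt_of_lt_of_le (by omega) (Finset.card_le_card Finset.subset_union_left)
  have hedge : M ≤ ∑ x ∈ A', ∑ y ∈ X, (W x y : ℝ) := by
    exact (le_mixing_bound hN0 hN hs0 hc0 hs15 hzM).trans hmix
  have hweight : (A.card : ℝ) * B.card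
      ≤ ∑ a ∈ A, ∑ b ∈ B, if dist a b ∈ J.toSet then (W a b : ℝ) * w else 0 := by
    refine le_trans ?_ (hmono _ hf0 A' hA' X ((Finset.filter_subset _ _).trans hB'))
    have : ∀ a ∈ A', ∀ b ∈ X, (if dist a b ∈ J.toSet then (W a b : ℝ) * w else 0)
        = (W a b : ℝ) * w := fun a ha b hb => if_pos ((Finset.mem_filter.mp hb).2 a ha)
    rw [Finset.sum_congr rfl fun a ha => Finset.sum_congr rfl (this a ha)]
    simp only [← Finset.sum_mul]
    calc (A.card : ℝ) * B.card = M * w := by rw [hw]; field_simp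
      _ ≤ _ := by gcongr
  have hq0 : 0 ≤ q := Finset.sum_nonneg fun a _ => Finset.sum_nonneg fun b _ => hg0 a b
  have : 0 ≤ q / (c ^ 2 / 2) := by positivity
  linarith

/-! ### Ordered pairs, and the blocks of a biclique. -/

open Classical in
/-- The ordered pairs of points of `P` with distance in `I`. -/
noncomputable def pairsIn (P : Finset Plane) (I : Interval) : Finset (Plane × Plane) :=
  (P ×ˢ P).filter fun x => dist x.1 x.2 ∈ I.toSet

open Classical in
theorem mem_pairsIn {P : Finset Plane} {I : Interval} {x : Plane × Plane} :
    x ∈ pairsIn P I ↔ (x.1 ∈ P ∧ x.2 ∈ P) ∧ dist x.1 x.2 ∈ I.toSet := by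
  rw [pairsIn, Finset.mem_filter, Finset.mem_product]

theorem ne_of_dist_mem {I : Interval} (hI : 0 ≤ I.lo) {a b : Plane} (h : dist a b ∈ I.toSet) :
    a ≠ b := by
  rintro rfl
  rw [dist_self] at h
  exact absurd h.1 (not_lt.mpr hI)

/-- Distance 0 lies outside `I`, so no diagonal pair occurs and each unordered pair is counted
exactly twice. -/
theorem card_pairsIn (P : Finset Plane) {I : Interval} (hI : 0 ≤ I.lo) :
    (pairsIn P I).card = 2 * countIn P I := by
  classical
  set T := (P.sym2.filter (fun e => ¬ e.IsDiag)).filter fun e =>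
    (Sym2.lift ⟨fun a b => dist a b, fun a b => dist_comm a b⟩ : Sym2 Plane → ℝ) e ∈ I.toSet with hT
  have hcount : countIn P I = T.card := by
    rw [countIn, interpointDistances, Multiset.countP_map]
    rw [hT, Finset.card_def, Finset.filter_val]
    congr
  have hmem : ∀ a b, s(a, b) ∈ T ↔ (a, b) ∈ pairsIn P I := by
    intro a b
    rw [hT, Finset.mem_filter, Finset.mem_filter, Finset.mk_mem_sym2_iff, Sym2.mk_isDiag_iff,
      Sym2.lift_mk, mem_pairsIn]
    exact ⟨fun h => ⟨h.1.1, h.2⟩, fun h => ⟨⟨h.1, ne_of_dist_mem hI h.2⟩, h.2⟩⟩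
  have hmaps : Set.MapsTo (fun x : Plane × Plane => s(x.1, x.2)) (pairsIn P I) T :=
    fun x hx => (hmem x.1 x.2).mpr hx
  rw [hcount, Finset.card_eq_sum_card_fiberwise hmaps, mul_comm]
  refine Finset.sum_const_nat fun e he => ?_
  induction e using Sym2.ind with
  | _ a b =>
    have hab := (hmem a b).mp he
    have hba := (hmem b a).mp (by rwa [Sym2.eq_swap])
    have hne : a ≠ b := ne_of_dist_mem hI (mem_pairsIn.mp hab).2
    rw [Finset.card_eq_two]
    refine ⟨(a, b), (b, a), fun h => hne (Prod.ext_iff.mp h).1, ?_⟩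
    ext ⟨x, y⟩
    simp only [Finset.mem_filter, Finset.mem_insert, Finset.mem_singleton, Sym2.eq_iff,
      Prod.mk.injEq]
    constructor
    · exact fun h => h.2
    · rintro (⟨rfl, rfl⟩ | ⟨rfl, rfl⟩)
      exacts [⟨hab, by simp⟩, ⟨hba, by simp⟩]

theorem card_major_mul_card_minor (p : Biclique) :
    (major p).card * (minor p).card = p.1.card * p.2.card := by
  unfold major minor
  split_ifs <;> ring

theorem sum_major_minor {p : Biclique} (f : Plane → Plane → ℝ) (hf : ∀ a b, f a b = f b a) :
    ∑ a ∈ major p, ∑ b ∈ minor p, f a b = ∑ a ∈ p.1, ∑ b ∈ p.2, f a b := by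
  unfold major minor
  split_ifs
  · rw [Finset.sum_comm]
    exact Finset.sum_congr rfl fun a _ => Finset.sum_congr rfl fun b _ => hf b a
  · rfl

theorem IsBlockPartition.sum_major {p : Biclique} {part : ℕ → Finset Plane}
    (h : IsBlockPartition p part) (f : Plane → ℝ) :
    ∑ a ∈ major p, f a = ∑ i ∈ Finset.range (numBlocks p), ∑ a ∈ part i, f a := by
  classical
  rw [← Finset.sum_biUnion]
  · refine Finset.sum_congr ?_ fun _ _ => rfl
    ext x
    simp [h.cover x]
  · intro i hi j hj hij
    exact h.disjoint i (by simpa using hi) j (by simpa using hj) hij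

theorem IsBlockPartition.card_bounds {p : Biclique} {part : ℕ → Finset Plane}
    (h : IsBlockPartition p part) (hp : (minor p).Nonempty) {i : ℕ} (hi : i < numBlocks p) :
    (minor p).card ≤ (part i).card ∧ (part i).card < 2 * (minor p).card := by
  rcases (Nat.succ_le_of_lt hi).lt_or_eq with h1 | h1
  · have := h.card_block i h1
    have := hp.card_pos
    omega
  · exact h.card_last i h1

/-! ### Bounding the uncertain pairs. -/

theorem sq_log_log_le (n : ℕ) : Real.log (Real.log n) ^ 2 ≤ 4 * Real.log n := by
  have hkey : ∀ x : ℝ, 1 ≤ x → Real.log x ^ 2 ≤ 4 * x := by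
    intro x hx
    have h0 : (0 : ℝ) < Real.sqrt x := Real.sqrt_pos.mpr (by linarith)
    have h1 : Real.log x = 2 * Real.log (Real.sqrt x) := by
      rw [Real.log_sqrt (by linarith)]; ring
    have h2 := Real.log_le_sub_one_of_pos h0
    have h3 : 0 ≤ Real.log x := Real.log_nonneg hx
    have h4 : Real.log x ≤ 2 * Real.sqrt x := by linarith
    calc Real.log x ^ 2 ≤ (2 * Real.sqrt x) ^ 2 := by gcongr
      _ = 4 * x := by rw [mul_pow, Real.sq_sqrt (by linarith)]; norm_num
  rcases lt_or_ge n 2 with hn | hn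
  · interval_cases n <;> simp
  have h2 : (1 / 2 : ℝ) ≤ Real.log n := by
    have : Real.log 2 ≤ Real.log n := Real.log_le_log (by norm_num) (by exact_mod_cast hn)
    linarith [Real.log_two_gt_d9]
  rcases le_total 1 (Real.log n) with h1 | h1
  · exact hkey _ h1
  · have h3 : Real.log (Real.log n) ≤ 0 := Real.log_nonpos (by linarith) h1
    have h4 := Real.one_sub_inv_le_log_of_pos (show 0 < Real.log n by linarith)
    have h5 : (Real.log n)⁻¹ ≤ 2 := by
      rw [inv_le_comm₀ (by linarith) (by norm_num)]; linarith
    nlinarith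

/-- The number of uncertain pairs is `O(n ^ (4 / 3) * log n)`. -/
theorem HasStageSize.numPairs_le {C : ℝ} {n : ℕ} {Γ U : Finset Biclique}
    (h : HasStageSize C n Γ U) :
    (numPairs U : ℝ) ≤ 4 * |C| ^ 3 * ((n : ℝ) ^ (4 / 3 : ℝ) * Real.log n) := by
  set L := Real.log (Real.log n)
  set N := (n : ℝ) ^ (4 / 3 : ℝ)
  have hN : 0 ≤ N := by positivity
  have hU : (U.card : ℝ) ≤ |C| * (N / L ^ 4) :=
    h.card_U.trans (mul_le_mul_of_nonneg_right (le_abs_self C) (by positivity))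
  have hp : ∀ p ∈ U, (p.1.card * p.2.card : ℝ) ≤ |C| ^ 2 * L ^ 6 := by
    intro p hp
    have h1 := h.card_left_U p hp
    have h2 := h.card_right_U p hp
    calc (p.1.card * p.2.card : ℝ) ≤ (C * L ^ 3) * (C * L ^ 3) :=
          mul_le_mul h1 h2 (Nat.cast_nonneg _) ((Nat.cast_nonneg _).trans h1)
      _ = |C| ^ 2 * L ^ 6 := by rw [sq_abs]; ring
  have hsum : (numPairs U : ℝ) ≤ U.card * (|C| ^ 2 * L ^ 6) := by
    rw [numPairs]
    push_cast
    exact (Finset.sum_le_sum hp).trans (by simp)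
  -- If `L = 0`, division by zero makes the left side 0.
  have hL : N / L ^ 4 * L ^ 6 ≤ N * L ^ 2 := by
    rcases eq_or_ne L 0 with h0 | h0
    · simp [h0]
    · exact le_of_eq (by field_simp)
  have hlog := sq_log_log_le n
  calc (numPairs U : ℝ) ≤ U.card * (|C| ^ 2 * L ^ 6) := hsum
    _ ≤ |C| * (N / L ^ 4) * (|C| ^ 2 * L ^ 6) := by gcongr
    _ = |C| ^ 3 * (N / L ^ 4 * L ^ 6) := by ring
    _ ≤ |C| ^ 3 * (N * (4 * Real.log n)) :=
      mul_le_mul_of_nonneg_left (hL.trans (mul_le_mul_of_nonneg_left hlog hN)) (by positivity)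
    _ = _ := by ring

/-! ### Pairs lost in a stage, and the resulting ratio. -/

theorem IsPartialBRS.card_pairsIn_le {P : Finset Plane} {I : Interval} {Γ U : Finset Biclique}
    (h : IsPartialBRS P P I Γ U) : (pairsIn P I).card ≤ numPairs Γ + numPairs U := by
  classical
  have hsub : pairsIn P I ⊆
      (Γ.biUnion fun p => p.1 ×ˢ p.2) ∪ U.biUnion fun p => p.1 ×ˢ p.2 := by
    intro x hx
    obtain ⟨⟨h1, h2⟩, h3⟩ := mem_pairsIn.mp hx
    simp only [Finset.mem_union, Finset.mem_biUnion, Finset.mem_product]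
    rcases h.complete _ h1 _ h2 h3 with ⟨p, hp, -⟩ | ⟨p, hp, -⟩
    exacts [Or.inl ⟨p, hp⟩, Or.inr ⟨p, hp⟩]
  refine (Finset.card_le_card hsub).trans ((Finset.card_union_le _ _).trans ?_)
  refine Nat.add_le_add (Finset.card_biUnion_le.trans (le_of_eq ?_))
    (Finset.card_biUnion_le.trans (le_of_eq ?_)) <;>
  simp [numPairs, Finset.card_product]

open Classical in
/-- The pairs of `Γ` whose distance is not in the subinterval `J` are lost in passing from `I`
to `J`. -/
theorem IsPartialBRS.sum_add_card_pairsIn_le {P : Finset Plane} {I J : Interval}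
    {Γ U : Finset Biclique} (h : IsPartialBRS P P I Γ U) (hJI : J.toSet ⊆ I.toSet) :
    (∑ p ∈ Γ, ∑ a ∈ p.1, ∑ b ∈ p.2, if dist a b ∈ J.toSet then (0 : ℝ) else 1)
      + (pairsIn P J).card ≤ (pairsIn P I).card := by
  let Q : Biclique → Finset (Plane × Plane) := fun p =>
    (p.1 ×ˢ p.2).filter fun x => dist x.1 x.2 ∉ J.toSet
  have hQ : ∀ p, ∑ a ∈ p.1, ∑ b ∈ p.2, (if dist a b ∈ J.toSet then (0 : ℝ) else 1)
      = (Q p).card := by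
    intro p
    rw [← Finset.sum_product', Finset.card_filter]
    push_cast
    exact Finset.sum_congr rfl fun x _ => by split_ifs <;> rfl
  have hcard : (Γ.biUnion Q).card = ∑ p ∈ Γ, (Q p).card :=
    Finset.card_biUnion fun p hp q hq hpq =>
      Finset.disjoint_filter_filter (h.edgeDisjoint_Γ p hp q hq hpq)
  have hdisj : Disjoint (Γ.biUnion Q) (pairsIn P J) := by
    rw [Finset.disjoint_left]
    intro x hx hxJ
    obtain ⟨p, -, hxp⟩ := Finset.mem_biUnion.mp hx
    exact (Finset.mem_filter.mp hxp).2 (mem_pairsIn.mp hxJ).2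
  have hsub : Γ.biUnion Q ∪ pairsIn P J ⊆ pairsIn P I := by
    intro x hx
    rcases Finset.mem_union.mp hx with hx | hx
    · obtain ⟨p, hp, hxp⟩ := Finset.mem_biUnion.mp hx
      obtain ⟨h1, h2⟩ := Finset.mem_product.mp (Finset.mem_filter.mp hxp).1
      exact mem_pairsIn.mpr ⟨⟨(h.subset_Γ p hp).1 h1, (h.subset_Γ p hp).2 h2⟩,
        h.sound p hp _ h1 _ h2⟩
    · obtain ⟨h1, h2⟩ := mem_pairsIn.mp hx
      exact mem_pairsIn.mpr ⟨h1, hJI h2⟩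
  have := Finset.card_le_card hsub
  rw [Finset.card_union_of_disjoint hdisj, hcard] at this
  simp only [hQ]
  exact_mod_cast this

theorem toSet_subset_of_consecutive {h : ℕ} {c : ℕ → EReal} (hc : ∀ i < h, c i ≤ c (i + 1))
    {l : ℕ} (hl : l < h) : Interval.toSet ⟨c l, c (l + 1)⟩ ⊆ Interval.toSet ⟨c 0, c h⟩ := by
  have hmono : ∀ i j, i ≤ j → j ≤ h → c i ≤ c j := by
    intro i j hij
    induction j, hij using Nat.le_induction with
    | base => exact fun _ => le_rfl
    | succ j _ ih => exact fun hj => (ih (by omega)).trans (hc j (by omega))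
  exact fun x hx => ⟨(hmono 0 l (by omega) hl.le).trans_lt hx.1,
    hx.2.trans (hmono (l + 1) h hl le_rfl)⟩

open Classical in
/-- In a stage with expanders of sufficiently large degree, a positive fraction of the recorded
pairs have their distance outside the next interval. -/
theorem exists_fraction_lost :
    ∃ (η : ℝ) (d₀ : ℕ), 0 < η ∧ η ≤ 1 ∧ ∀ d ≥ d₀, ∀ (C : ℝ) (P : Finset Plane) (k : ℕ)
      (I J : Interval) (s : Stage d C P k I J),
      η / 2 * numPairs s.Γ ≤
        ∑ p ∈ s.Γ, ∑ a ∈ p.1, ∑ b ∈ p.2, if dist a b ∈ J.toSet then (0 : ℝ) else 1 := by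
  obtain ⟨η, d₀, hη0, hη1, hblock⟩ := card_mul_card_le_of_expander
  refine ⟨η, d₀, hη0, hη1, fun d hd C P k I J s => ?_⟩
  let q : Plane → Plane → ℝ := fun a b => if dist a b ∈ J.toSet then 0 else 1
  let w : Biclique → ℕ → ℝ := fun p i => ∑ a ∈ s.part p i, ∑ b ∈ minor p,
    if dist a b ∈ J.toSet then
      (s.G p i a b : ℝ) * (((s.part p i).card : ℝ) * ((minor p).card : ℝ)
        / (((s.part p i).card : ℝ) + ((minor p).card : ℝ)))
    else 0
  have hw : ∑ p ∈ s.Γ, ∑ i ∈ Finset.range (numBlocks p), w p i ≤ (numPairs s.Γ : ℝ) / 2 := by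
    have := s.weight_le s.l s.l_lt
    rw [← s.J_eq] at this
    exact this
  have hp : ∀ p ∈ s.Γ, ((p.1.card * p.2.card : ℕ) : ℝ) ≤
      (∑ a ∈ p.1, ∑ b ∈ p.2, q a b) / η + ∑ i ∈ Finset.range (numBlocks p), w p i := by
    intro p hp
    rw [← card_major_mul_card_minor, ← sum_major_minor q fun a b => by simp only [q, dist_comm]]
    rcases (minor p).eq_empty_or_nonempty with h0 | h0
    · simp [h0, numBlocks]
    have hpart := s.isPartition p hp h0
    have hcard : ((major p).card : ℝ)
        = ∑ i ∈ Finset.range (numBlocks p), ((s.part p i).card : ℝ) := by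
      simpa using hpart.sum_major fun _ => (1 : ℝ)
    rw [Nat.cast_mul, hcard, hpart.sum_major fun a => ∑ b ∈ minor p, q a b, Finset.sum_mul,
      Finset.sum_div, ← Finset.sum_add_distrib]
    refine Finset.sum_le_sum fun i hi => ?_
    have hi' := Finset.mem_range.mp hi
    obtain ⟨h1, h2⟩ := hpart.card_bounds h0 hi'
    exact hblock d hd _ _ J _ h1 h2 (s.isExpander p hp i hi')
  have hsum := Finset.sum_le_sum hp
  rw [Finset.sum_add_distrib, ← Finset.sum_div, ← Nat.cast_sum] at hsum
  change (numPairs s.Γ : ℝ) ≤ _ at hsum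
  -- The weight in `J` accounts for at most half of `m`, so the lost pairs account for the other
  -- half.
  have : (numPairs s.Γ : ℝ) / 2 ≤ (∑ p ∈ s.Γ, ∑ a ∈ p.1, ∑ b ∈ p.2, q a b) / η := by linarith
  rw [le_div_iff₀ hη0] at this
  change _ ≤ ∑ p ∈ s.Γ, ∑ a ∈ p.1, ∑ b ∈ p.2, q a b
  linarith

end DistanceSelection

theorem lemma4 :
    ∃ d₀ : ℕ, ∀ C : ℝ, ∃ ρ : ℝ, 0 < ρ ∧ ρ < 1 ∧
      ∀ (d : ℕ), d₀ ≤ d →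
      ∀ (P : Finset DistanceSelection.Plane) (k : ℕ) (I J : DistanceSelection.Interval),
        DistanceSelection.Stage d C P k I J →
          (DistanceSelection.countIn P J : ℝ) ≤ ρ * (DistanceSelection.countIn P I : ℝ) := by
  obtain ⟨η, d₀, hη0, hη1, hlost⟩ := DistanceSelection.exists_fraction_lost
  refine ⟨d₀, fun C => ?_⟩
  set K : ℝ := 4 * |C| ^ 3 with hK
  have hK0 : 0 ≤ K := by positivity
  have hfrac : η / (2 * (1 + K)) ≤ 1 / 2 := by
    rw [div_le_iff₀ (by positivity)]; linarith
  have hfrac0 : 0 < η / (2 * (1 + K)) := by positivity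
  -- At least `η / 2 * m` ordered pairs are lost, out of at most `(1 + K) * m`.
  refine ⟨1 - η / (2 * (1 + K)), by linarith, by linarith, fun d hd P k I J s => ?_⟩
  have hJI : J.toSet ⊆ I.toSet := by
    have := DistanceSelection.toSet_subset_of_consecutive s.c_mono s.l_lt
    rwa [← s.J_eq, s.c_zero, s.c_last] at this
  have hJlo : 0 ≤ J.lo := by
    have hle : ∀ i ≤ s.h, s.c 0 ≤ s.c i := by
      intro i
      induction i with
      | zero => exact fun _ => le_rfl
      | succ i ih => exact fun hi => (ih (by omega)).trans (s.c_mono i (by omega))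
    rw [s.J_eq]
    exact (s.lo_nonneg.trans s.c_zero.ge).trans (hle s.l s.l_lt.le)
  have h1 := hlost d hd C P k I J s
  have h2 := s.isBRS.sum_add_card_pairsIn_le hJI
  have h3 : ((DistanceSelection.pairsIn P I).card : ℝ)
      ≤ DistanceSelection.numPairs s.Γ + DistanceSelection.numPairs s.U := by
    exact_mod_cast s.isBRS.card_pairsIn_le
  have h4 := s.size.numPairs_le
  have h5 := mul_le_mul_of_nonneg_left s.not_last.le hK0
  rw [DistanceSelection.card_pairsIn P hJlo, DistanceSelection.card_pairsIn P s.lo_nonneg] at h2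
  rw [DistanceSelection.card_pairsIn P s.lo_nonneg] at h3
  push_cast at h2 h3
  have h6 : η / (2 * (1 + K)) * (2 * DistanceSelection.countIn P I)
      ≤ η / 2 * DistanceSelection.numPairs s.Γ := by
    have h7 : (2 * DistanceSelection.countIn P I : ℝ)
        ≤ (1 + K) * DistanceSelection.numPairs s.Γ := by linarith
    calc η / (2 * (1 + K)) * (2 * DistanceSelection.countIn P I : ℝ)
        ≤ η / (2 * (1 + K)) * ((1 + K) * DistanceSelection.numPairs s.Γ) := by gcongr
      _ = η / 2 * DistanceSelection.numPairs s.Γ := by field_simp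
  linarith
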